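/- Fix $d$ and equip $\mathbb{R}^d$ with the norm $\|x\|=\max_i|x_i|$; let $B_r(x)$ be the closed ball of radius $r$ about $x$, so $B_1(0)=[-1,1]^d$. Let $\mathcal{M}$ be the space of Radon measures on $\mathbb{R}^d$ with its Borel structure, and $\mathcal{M}^*=\{\mu\in\mathcal{M}:\mu(B_1(0))=1\}$. For $\mu\in\mathcal{M}$ with $0<\mu(B_1(0))<\infty$ put $\mu^*=\mu/\mu(B_1(0))$. For $t\in\mathbb{R}$ let $S_t^*\mu=(S_t\mu)^*$, where $S_t\mu$ is the push-forward of $\mu$ under $y\mapsto e^ty$, and for $x\in\mathbb{R}^d$ let $T_x^*\mu=(T_x\mu)^*$, where $T_x\mu$ is the push-forward of $\mu$ under $y\mapsto y-x$. A fractal distribution is a Borel probability measure $P$ on $\mathcal{M}^*$ which is invariant under $S_t^*$ for all $t\in\mathbb{R}$ and is quasi-Palm: for every bounded open neighborhood $U$ of the origin, the measures $P$ and $\int\left(\int_U\delta_{T_x^*\mu}\,d\mu(x)\right)dP(\mu)$ have the same null sets. It is ergodic if $P(A)\in\{0,1\}$ for every measurable $A$ with $P\big((S_t^*)^{-1}A\,\triangle\,A\big)=0$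 for all $t\in\mathbb{R}$. A measure $\mu\in\mathcal{M}$ is exact dimensional with dimension $\dim\mu=\alpha$ if for $\mu$-a.e. $x$ $$\liminf_{r\to0}\frac{\log\mu(B_r(x))}{\log r}=\limsup_{r\to0}\frac{\log\mu(B_r(x))}{\log r}=\alpha .$$ Let $P$ be an ergodic fractal distribution. Then there is a real number $\dim P$ such that $P$-a.e. $\mu$ is exact dimensional with $\dim\mu=\dim P$. Moreover, for every $0<r<1$ the function $\mu\mapsto\log\mu(B_r(0))/\log r$ is $P$-integrable and $$\dim P=\int\frac{\log\mu(B_r(0))}{\log r}\,dP(\mu).$$ -/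

import Mathlib

open MeasureTheory Metric Set Filter
open scoped Topology ENNReal

noncomputable section

namespace FractalDistribution

/-- The space `ℝ^d`. As a space of functions it carries the sup norm, so `closedBall x r` is the
closed cube of side `2r` centred at `x`, and `closedBall 0 1 = [-1,1]^d`. -/
abbrev Space (d : ℕ) : Type := Fin d → ℝ

/-- The Radon measures on `ℝ^d`: the Borel measures that are finite on compact sets. As everywhere
in Mathlib, measurable sets of measures are those of the smallest σ-algebra for which all the
evaluations `μ ↦ μ A`, `A` Borel, are measurable; on Radon measures on `ℝ^d` it is the Borel
σ-algebra of the weak-* topology. -/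
def radonMeasures (d : ℕ) : Set (Measure (Space d)) :=
  {μ | IsLocallyFiniteMeasure μ}

/-- The Radon measures normalized by `μ [-1,1]^d = 1`. -/
def normalizedMeasures (d : ℕ) : Set (Measure (Space d)) :=
  {μ | μ ∈ radonMeasures d ∧ μ (closedBall 0 1) = 1}

variable {d : ℕ}

/-- `μ^* = μ / μ [-1,1]^d`, meaningful when `0 < μ [-1,1]^d < ∞`. If `μ [-1,1]^d = 0`, the value is
a measure that is not normalized. -/
def normalize (μ : Measure (Space d)) : Measure (Space d) :=
  (μ (closedBall 0 1))⁻¹ • μ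

/-- `S_t^* μ`: the image of `μ` under `y ↦ e^t y`, normalized. -/
def scaleStar (t : ℝ) (μ : Measure (Space d)) : Measure (Space d) :=
  normalize (μ.map fun y => Real.exp t • y)

/-- `T_x^* μ`: the image of `μ` under `y ↦ y - x`, normalized. -/
def translateStar (x : Space d) (μ : Measure (Space d)) : Measure (Space d) :=
  normalize (μ.map fun y => y - x)

/-- The `U`-diffusion `⟨μ⟩_U = ∫_U δ_{T_x^* μ} dμ(x)`: the image of the restriction of `μ` to `U`
under `x ↦ T_x^* μ`. -/
def diffusion (U : Set (Space d)) (μ : Measure (Space d)) : Measure (Measure (Space d)) :=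
  (μ.restrict U).map fun x => translateStar x μ

/-- `P` is quasi-Palm: `P` and `∫ ⟨μ⟩_U dP(μ)` have the same null sets for every bounded open
neighbourhood `U` of the origin. -/
def IsQuasiPalm (P : Measure (Measure (Space d))) : Prop :=
  ∀ U : Set (Space d), IsOpen U → Bornology.IsBounded U → (0 : Space d) ∈ U →
    P ≪ P.bind (diffusion U) ∧ P.bind (diffusion U) ≪ P

/-- A fractal distribution: a probability distribution on the normalized Radon measures which is
invariant under the scaling flow `S^*` and quasi-Palm. -/
structure IsFractalDistribution (P : Measure (Measure (Space d))) : Prop where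
  isProbabilityMeasure : IsProbabilityMeasure P
  ae_mem : ∀ᵐ μ ∂P, μ ∈ normalizedMeasures d
  invariant : ∀ t : ℝ, MeasurePreserving (scaleStar t) P P
  quasiPalm : IsQuasiPalm P

/-- An ergodic fractal distribution: one for which every (mod `P`) `S^*`-invariant measurable set
has probability `0` or `1`. -/
structure IsErgodicFractalDistribution (P : Measure (Measure (Space d))) : Prop
    extends IsFractalDistribution P where
  ergodic : ∀ A : Set (Measure (Space d)), MeasurableSet A →
    (∀ t : ℝ, P (symmDiff (scaleStar t ⁻¹' A) A) = 0) → P A = 0 ∨ P A = 1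

/-- The quotient `log μ(B_r(x)) / log r`, in the extended reals, with `log 0 = -∞`. -/
def logQuotient (μ : Measure (Space d)) (x : Space d) (r : ℝ) : EReal :=
  ENNReal.log (μ (closedBall x r)) / (Real.log r : EReal)

/-- The upper local dimension of `μ` at `x`. -/
def upperLocalDim (μ : Measure (Space d)) (x : Space d) : EReal :=
  limsup (logQuotient μ x) (𝓝[>] (0 : ℝ))

/-- The lower local dimension of `μ` at `x`. -/
def lowerLocalDim (μ : Measure (Space d)) (x : Space d) : EReal :=
  liminf (logQuotient μ x) (𝓝[>] (0 : ℝ))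

/-- `μ` is exact dimensional with exact dimension `α`: at `μ`-a.e. point the upper and lower local
dimensions agree, and their common value is `α`. -/
def HasExactDim (μ : Measure (Space d)) (α : EReal) : Prop :=
  ∀ᵐ x ∂μ, lowerLocalDim μ x = α ∧ upperLocalDim μ x = α

/-! Measurability of the maps above, so that the push-forwards and integrals in the definitions are
the genuine ones. -/

lemma measurable_normalize : Measurable (normalize (d := d)) := by
  refine Measure.measurable_of_measurable_coe _ fun s hs => ?_
  simp only [normalize, Measure.smul_apply, smul_eq_mul]
  exact (Measure.measurable_coe measurableSet_closedBall).inv.mul (Measure.measurable_coe hs)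

lemma measurable_scaleStar (t : ℝ) : Measurable (scaleStar (d := d) t) :=
  measurable_normalize.comp (Measure.measurable_map _ (by fun_prop))

lemma mem_radonMeasures_iff (μ : Measure (Space d)) :
    μ ∈ radonMeasures d ↔ ∀ n : ℕ, μ (closedBall 0 n) < ∞ := by
  constructor
  · intro h n
    have : IsLocallyFiniteMeasure μ := h
    exact (isCompact_closedBall _ _).measure_lt_top
  · intro h
    refine ⟨fun x => ?_⟩
    obtain ⟨n, hn⟩ := exists_nat_gt (dist x 0)
    exact ⟨closedBall 0 n, mem_of_superset (isOpen_ball.mem_nhds (by simpa using hn)) ball_subset_closedBall, h n⟩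

lemma measurableSet_radonMeasures : MeasurableSet (radonMeasures d) := by
  have : radonMeasures d = ⋂ n : ℕ, {μ | μ (closedBall 0 n) < ∞} := by
    ext μ; simp [mem_radonMeasures_iff]
  rw [this]
  exact MeasurableSet.iInter fun n =>
    measurableSet_lt (Measure.measurable_coe measurableSet_closedBall) measurable_const

/-- The tautological kernel `μ ↦ μ` on Radon measures. -/
def idKernel (d : ℕ) : ProbabilityTheory.Kernel (radonMeasures d) (Space d) := ⟨Subtype.val, measurable_subtype_coe⟩

instance isSFiniteKernel_idKernel : ProbabilityTheory.IsSFiniteKernel (idKernel d) := by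
  let A : ℕ → Set (Space d) := disjointed fun n => closedBall 0 (n : ℝ)
  have hA : ∀ n, MeasurableSet (A n) := MeasurableSet.disjointed fun n => measurableSet_closedBall
  have hAU : ⋃ n, A n = univ := by
    rw [iUnion_disjointed]; exact iUnion_closedBall_nat 0
  have hAd : Pairwise (Function.onFun Disjoint A) := disjoint_disjointed _
  have hfin : ∀ (μ : radonMeasures d) n, (μ : Measure (Space d)) (A n) < ∞ := fun μ n =>
    (measure_mono (disjointed_subset _ n)).trans_lt ((mem_radonMeasures_iff _).1 μ.2 n)
  have key : idKernel d = ProbabilityTheory.Kernel.sum fun n => (idKernel d).restrict (hA n) := by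
    ext μ s hs
    rw [ProbabilityTheory.Kernel.sum_apply' _ _ hs]
    simp_rw [ProbabilityTheory.Kernel.restrict_apply]
    rw [← Measure.sum_apply _ hs, ← Measure.restrict_iUnion hAd hA, hAU, Measure.restrict_univ]
  rw [key]
  refine ProbabilityTheory.Kernel.isSFiniteKernel_sum (hκs := fun n => ?_)
  let B : ℕ → Set (radonMeasures d) := fun k => {μ | ⌊((μ : Measure (Space d)) (A n)).toNNReal⌋₊ = k}
  have hm : Measurable fun μ : radonMeasures d => (μ : Measure (Space d)) (A n) :=
    (Measure.measurable_coe (hA n)).comp measurable_subtype_coe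
  have hB : ∀ k, MeasurableSet (B k) := fun k =>
    (Nat.measurable_floor.comp hm.ennreal_toNNReal) (measurableSet_singleton k)
  classical
  have key2 : (idKernel d).restrict (hA n)
      = ProbabilityTheory.Kernel.sum fun k => ProbabilityTheory.Kernel.piecewise (hB k) ((idKernel d).restrict (hA n)) 0 := by
    ext μ s hs
    rw [ProbabilityTheory.Kernel.sum_apply' _ _ hs]
    simp only [ProbabilityTheory.Kernel.piecewise_apply']
    rw [tsum_eq_single ⌊((μ : Measure (Space d)) (A n)).toNNReal⌋₊]
    · simp [B]
    · intro k hk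
      have : μ ∉ B k := fun h => hk h.symm
      simp [this]
  rw [key2]
  refine ProbabilityTheory.Kernel.isSFiniteKernel_sum (hκs := fun k => ?_)
  have : ProbabilityTheory.IsFiniteKernel (ProbabilityTheory.Kernel.piecewise (hB k) ((idKernel d).restrict (hA n)) 0) := by
    refine ⟨(k + 1 : ℝ≥0∞), by finiteness, fun μ => ?_⟩
    rw [ProbabilityTheory.Kernel.piecewise_apply']
    split_ifs with h
    · rw [ProbabilityTheory.Kernel.restrict_apply, Measure.restrict_apply_univ]
      have h2 : ⌊((μ : Measure (Space d)) (A n)).toNNReal⌋₊ = k := h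
      have := (Nat.lt_floor_add_one ((μ : Measure (Space d)) (A n)).toNNReal).le
      rw [h2] at this
      change (μ : Measure (Space d)) (A n) ≤ _
      rw [← ENNReal.coe_toNNReal (hfin μ n).ne]
      exact_mod_cast this
    · simp
  infer_instance

lemma measurable_translate : Measurable fun p : radonMeasures d × Space d => translateStar p.2 p.1 := by
  refine measurable_normalize.comp ?_
  refine Measure.measurable_of_measurable_coe _ fun s hs => ?_
  have : ∀ p : radonMeasures d × Space d, ((p.1 : Measure (Space d)).map fun y => y - p.2) s =
      (ProbabilityTheory.Kernel.prodMkRight (Space d) (idKernel d)) p (Prod.mk p ⁻¹' {q | q.2 - q.1.2 ∈ s}) := by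
    intro p
    rw [Measure.map_apply (by fun_prop) hs]; rfl
  simp_rw [this]
  refine ProbabilityTheory.Kernel.measurable_kernel_prodMk_left ?_
  exact (measurable_snd.sub measurable_fst.snd) hs

lemma measurable_translateStar_left {μ : Measure (Space d)} (h : μ ∈ radonMeasures d) :
    Measurable fun x => translateStar x μ := by
  have h0 : Measurable fun x : Space d => ((⟨μ, h⟩, x) : radonMeasures d × Space d) :=
    measurable_prodMk_left
  simpa only [Function.comp_def] using (measurable_translate (d := d)).comp h0

lemma measurable_diffusion {U : Set (Space d)} (hU : MeasurableSet U) :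
    Measurable fun μ : radonMeasures d => diffusion U (μ : Measure (Space d)) := by
  refine Measure.measurable_of_measurable_coe _ fun s hs => ?_
  have hV : MeasurableSet {q : radonMeasures d × Space d | translateStar q.2 q.1 ∈ s ∧ q.2 ∈ U} :=
    (measurable_translate hs).inter (measurable_snd hU)
  have h2 := ProbabilityTheory.Kernel.measurable_kernel_prodMk_left (κ := idKernel d) hV
  convert h2 using 1
  funext μ
  have h1 := measurable_translateStar_left μ.2
  rw [diffusion, Measure.map_apply h1 hs, Measure.restrict_apply (h1 hs)]
  rfl

/-- The integrand of `∫ ⟨μ⟩_U dP(μ)` is measurable, so `P.bind (diffusion U)` is that integral. -/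
lemma aemeasurable_diffusion {P : Measure (Measure (Space d))} (hP : ∀ᵐ μ ∂P, μ ∈ radonMeasures d)
    {U : Set (Space d)} (hU : MeasurableSet U) : AEMeasurable (diffusion U) P := by
  rw [← Measure.restrict_eq_self_of_ae_mem hP,
    aemeasurable_restrict_iff_comap_subtype measurableSet_radonMeasures]
  exact (measurable_diffusion hU).aemeasurable

end FractalDistribution

end

/-!
Put `N_t(μ) = -log μ(B_{e^{-t}}(0))`. Along the scaling flow `S^*` it is an additive cocycle,
`N_t(S_s^* μ) = N_{s+t}(μ) - N_s(μ)`, and it increases with `t`. Its upper growth rate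
`limsup N_t / t` is invariant under the flow, hence almost surely constant, and the maximal ergodic
theorem for the time `h` map shows that this constant is at most `(∫ N_h dP) / h`; the same argument
applied to `-N` shows that `N_t / t` tends almost surely to `(∫ N_h dP) / h`.

The integrability of `N_h` comes from the quasi-Palm property. By differentiation with respect to
Lebesgue measure, almost every point of a Radon measure on `ℝ^d` has positive lower `d`-density, so
almost surely `limsup N_t / t ≤ d`, and the maximal ergodic theorem for the truncations of `N_h`
bounds their means. The quasi-Palm property also carries the limit from the origin to `μ`-almost
every point `x`, where it is the local dimension of `μ`.
-/

section MaximalErgodic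

variable {X : Type*} {T : X → X} {g : X → ℝ}

lemma partialSups_birkhoffSum_succ (T : X → X) (g : X → ℝ) (N : ℕ) (x : X) :
    partialSups (birkhoffSum T g) (N + 1) x =
      max 0 (g x + partialSups (birkhoffSum T g) N (T x)) := by
  simp only [Pi.partialSups_apply, partialSups_add_one', Nat.bot_eq_zero, birkhoffSum_zero,
    Function.comp_def, birkhoffSum_succ', partialSups_const_add]

lemma partialSups_birkhoffSum_nonneg (T : X → X) (g : X → ℝ) (N : ℕ) (x : X) :
    0 ≤ partialSups (birkhoffSum T g) N x :=
  le_partialSups_of_le (birkhoffSum T g) N.zero_le x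

lemma nonneg_add_partialSups_birkhoffSum_iff {N : ℕ} {x : X} :
    0 ≤ g x + partialSups (birkhoffSum T g) N (T x) ↔
      ∃ n ≤ N, 0 ≤ birkhoffSum T g (n + 1) x := by
  simp only [birkhoffSum_succ', Pi.partialSups_apply]
  constructor
  · intro h
    obtain ⟨n, hn, hmax⟩ := exists_partialSups_eq (fun k => birkhoffSum T g k (T x)) N
    exact ⟨n, hn, hmax ▸ h⟩
  · rintro ⟨n, hn, h⟩
    exact h.trans (by gcongr; exact le_partialSups_of_le (fun k => birkhoffSum T g k (T x)) hn)

variable [MeasurableSpace X] {μ : Measure X}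

lemma integrable_birkhoffSum (hT : MeasurePreserving T μ μ) (hg : Integrable g μ) (n : ℕ) :
    Integrable (birkhoffSum T g n) μ :=
  integrable_finsetSum _ fun k _ => (hT.iterate k).integrable_comp_of_integrable hg

lemma integrable_partialSups_birkhoffSum (hT : MeasurePreserving T μ μ) (hg : Integrable g μ)
    (N : ℕ) : Integrable (partialSups (birkhoffSum T g) N) μ := by
  induction N with
  | zero => simpa only [partialSups_zero] using integrable_birkhoffSum hT hg 0
  | succ N ih => simpa only [partialSups_add_one] using ih.sup (integrable_birkhoffSum hT hg _)

lemma nullMeasurableSet_exists_le_birkhoffSum_nonneg (hT : MeasurePreserving T μ μ)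
    (hg : Integrable g μ) (N : ℕ) :
    NullMeasurableSet {x | ∃ n ≤ N, 0 ≤ birkhoffSum T g (n + 1) x} μ := by
  simp only [← nonneg_add_partialSups_birkhoffSum_iff]
  exact nullMeasurableSet_le aemeasurable_const (hg.aemeasurable.add
    (hT.integrable_comp_of_integrable
      (integrable_partialSups_birkhoffSum hT hg N)).aemeasurable)

/- Garsia's argument: with `M N` the largest of the Birkhoff sums of length at most `N`, the
indicator of `g` on the set in question dominates `M (N + 1) - M N ∘ T`, and that difference has a
nonnegative integral because `M N ≤ M (N + 1)` and `T` preserves `μ`. -/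
theorem setIntegral_nonneg_exists_le_birkhoffSum_nonneg (hT : MeasurePreserving T μ μ)
    (hg : Integrable g μ) (N : ℕ) :
    0 ≤ ∫ x in {x | ∃ n ≤ N, 0 ≤ birkhoffSum T g (n + 1) x}, g x ∂μ := by
  set M := partialSups (birkhoffSum T g)
  have hM : ∀ N, Integrable (M N) μ := integrable_partialSups_birkhoffSum hT hg
  have hMT : Integrable (fun x => M N (T x)) μ := hT.integrable_comp_of_integrable (hM N)
  have hinv : ∫ x, M N (T x) ∂μ = ∫ x, M N x ∂μ := by
    rw [← integral_map hT.aemeasurable (hT.map_eq.symm ▸ (hM N).aestronglyMeasurable), hT.map_eq]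
  have hE := nullMeasurableSet_exists_le_birkhoffSum_nonneg hT hg N
  rw [← integral_indicator₀ hE]
  calc (0 : ℝ) ≤ ∫ x, M (N + 1) x ∂μ - ∫ x, M N (T x) ∂μ := by
        rw [hinv, sub_nonneg]
        exact integral_mono (hM N) (hM (N + 1)) ((partialSups (birkhoffSum T g)).mono N.le_succ)
    _ = ∫ x, (M (N + 1) x - M N (T x)) ∂μ := (integral_sub (hM _) hMT).symm
    _ ≤ _ := by
        refine integral_mono ((hM _).sub hMT) (hg.indicator₀ hE) fun x => ?_
        have hrec : M (N + 1) x = max 0 (g x + M N (T x)) := partialSups_birkhoffSum_succ T g N x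
        by_cases hx : ∃ n ≤ N, 0 ≤ birkhoffSum T g (n + 1) x
        · rw [indicator_of_mem (by exact hx), hrec,
            max_eq_right (nonneg_add_partialSups_birkhoffSum_iff.2 hx), add_sub_cancel_right]
        · rw [indicator_of_notMem (by exact hx), hrec, max_eq_left
            (not_le.1 (mt nonneg_add_partialSups_birkhoffSum_iff.1 hx)).le, zero_sub]
          exact neg_nonpos.2 (partialSups_birkhoffSum_nonneg T g N (T x))

theorem setIntegral_nonneg_exists_birkhoffSum_nonneg (hT : MeasurePreserving T μ μ)
    (hg : Integrable g μ) :
    0 ≤ ∫ x in {x | ∃ n, 0 ≤ birkhoffSum T g (n + 1) x}, g x ∂μ := by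
  have hunion : {x | ∃ n, 0 ≤ birkhoffSum T g (n + 1) x} =
      ⋃ N, {x | ∃ n ≤ N, 0 ≤ birkhoffSum T g (n + 1) x} := by
    ext x
    simp only [mem_iUnion, mem_ofPred_eq]
    exact ⟨fun ⟨n, hn⟩ => ⟨n, n, le_rfl, hn⟩, fun ⟨_, n, _, hn⟩ => ⟨n, hn⟩⟩
  rw [hunion]
  exact ge_of_tendsto'
    (tendsto_setIntegral_of_monotone₀ (nullMeasurableSet_exists_le_birkhoffSum_nonneg hT hg)
      (fun _ _ hNN' _ ⟨n, hn, hx⟩ => ⟨n, hn.trans hNN', hx⟩) hg.integrableOn)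
    (setIntegral_nonneg_exists_le_birkhoffSum_nonneg hT hg)

variable [IsProbabilityMeasure μ] {f : X → ℝ} {c : ℝ}

theorem le_integral_of_ae_exists_le_birkhoffAverage (hT : MeasurePreserving T μ μ)
    (hf : Integrable f μ) (h : ∀ᵐ x ∂μ, ∃ n, c ≤ birkhoffAverage ℝ T f (n + 1) x) :
    c ≤ ∫ x, f x ∂μ := by
  have hmax := setIntegral_nonneg_exists_birkhoffSum_nonneg hT (hf.sub (integrable_const c))
  rw [setIntegral_eq_integral_of_ae_compl_eq_zero, integral_sub' hf (integrable_const c)] at hmax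
  · simpa using hmax
  · filter_upwards [h] with x ⟨n, hn⟩ hx
    refine absurd ⟨n, ?_⟩ hx
    rw [birkhoffAverage, smul_eq_mul, le_inv_mul_iff₀ (by positivity)] at hn
    simpa [birkhoffSum_sub, birkhoffSum_of_comp_eq (φ := fun _ => c) rfl] using hn

theorem integral_le_of_ae_exists_birkhoffAverage_le (hT : MeasurePreserving T μ μ)
    (hf : Integrable f μ) (h : ∀ᵐ x ∂μ, ∃ n, birkhoffAverage ℝ T f (n + 1) x ≤ c) :
    ∫ x, f x ∂μ ≤ c := by
  have hneg : -c ≤ ∫ x, -f x ∂μ :=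
    le_integral_of_ae_exists_le_birkhoffAverage hT hf.neg <| h.mono fun x ⟨n, hn⟩ => ⟨n, by
      simpa only [← Pi.neg_def, birkhoffAverage_neg, Pi.neg_apply, neg_le_neg_iff] using hn⟩
  rwa [integral_neg, neg_le_neg_iff] at hneg

theorem integrable_of_ae_exists_birkhoffAverage_le (hT : MeasurePreserving T μ μ)
    (hfm : AEMeasurable f μ) (hf : 0 ≤ᵐ[μ] f)
    (h : ∀ᵐ x ∂μ, ∃ n, birkhoffAverage ℝ T f (n + 1) x ≤ c) : Integrable f μ := by
  have hnonneg : ∀ K : ℕ, 0 ≤ᵐ[μ] fun x => min (f x) K := fun K =>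
    hf.mono fun x hx => le_min hx K.cast_nonneg
  have hint : ∀ K : ℕ, Integrable (fun x => min (f x) K) μ := fun K =>
    Integrable.of_bound (hfm.min aemeasurable_const).aestronglyMeasurable K <|
      (hnonneg K).mono fun x hx => by
        rw [Real.norm_of_nonneg hx]
        exact min_le_right _ _
  have hle : ∀ K : ℕ, ∫ x, min (f x) K ∂μ ≤ c := fun K =>
    integral_le_of_ae_exists_birkhoffAverage_le hT (hint K) <| h.mono fun x ⟨n, hn⟩ =>
      ⟨n, hn.trans' (by
        unfold birkhoffAverage birkhoffSum
        gcongr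
        exact min_le_left _ _)⟩
  have hlim : ∀ x, Tendsto (fun K : ℕ => ENNReal.ofReal (min (f x) K)) atTop
      (𝓝 (ENNReal.ofReal (f x))) := fun x =>
    tendsto_const_nhds.congr' <|
      (tendsto_natCast_atTop_atTop.eventually_ge_atTop (f x)).mono fun K hK => by
        simp only [min_eq_left hK]
  refine ⟨hfm.aestronglyMeasurable, (hasFiniteIntegral_iff_ofReal hf).2 ?_⟩
  calc ∫⁻ x, ENNReal.ofReal (f x) ∂μ
      = ∫⁻ x, liminf (fun K : ℕ => ENNReal.ofReal (min (f x) K)) atTop ∂μ :=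
        lintegral_congr fun x => (hlim x).liminf_eq.symm
    _ ≤ liminf (fun K : ℕ => ∫⁻ x, ENNReal.ofReal (min (f x) K) ∂μ) atTop :=
        lintegral_liminf_le' fun K => (hfm.min aemeasurable_const).ennreal_ofReal
    _ ≤ liminf (fun _ : ℕ => ENNReal.ofReal c) atTop :=
        liminf_le_liminf <| Eventually.of_forall fun K => by
          rw [← ofReal_integral_eq_lintegral_ofReal (hint K) (hnonneg K)]
          exact ENNReal.ofReal_le_ofReal (hle K)
    _ < ∞ := by simp only [liminf_const, ENNReal.ofReal_lt_top]

end MaximalErgodic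

section GrowthRate

variable {f : ℝ → ℝ} {h : ℝ}

/-- The upper growth rate `limsup f t / t` as `t → ∞`, taken in the extended reals so that it is
meaningful for every `f`. -/
noncomputable def upperGrowthRate (f : ℝ → ℝ) : EReal :=
  limsup (fun t => ((f t / t : ℝ) : EReal)) atTop

lemma upperGrowthRate_le_iff {c : EReal} :
    upperGrowthRate f ≤ c ↔ ∀ q : ℝ, c < q → ∀ᶠ t in atTop, f t ≤ q * t := by
  rw [upperGrowthRate, limsup_le_iff]
  constructor <;> intro H q hq
  · filter_upwards [H q hq, eventually_gt_atTop 0] with t ht ht0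
    exact ((div_lt_iff₀ ht0).1 (EReal.coe_lt_coe_iff.1 ht)).le
  · obtain ⟨q', hcq', hq'q⟩ := EReal.lt_iff_exists_real_btwn.1 hq
    filter_upwards [H q' hcq', eventually_gt_atTop 0] with t ht ht0
    exact (EReal.coe_le_coe_iff.2 ((div_le_iff₀ ht0).2 ht)).trans_lt hq'q

lemma upperGrowthRate_comp_add_sub_le (f : ℝ → ℝ) (s b : ℝ) :
    upperGrowthRate (fun t => f (s + t) - b) ≤ upperGrowthRate f := by
  refine upperGrowthRate_le_iff.2 fun q hq => ?_
  obtain ⟨q', hfq', hq'q⟩ := EReal.lt_iff_exists_real_btwn.1 hq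
  have hq'q : 0 < q - q' := sub_pos.2 (EReal.coe_lt_coe_iff.1 hq'q)
  have hf := upperGrowthRate_le_iff.1 le_rfl q' hfq'
  filter_upwards [(tendsto_atTop_add_const_left _ s tendsto_id).eventually hf,
    eventually_ge_atTop ((q' * s - b) / (q - q'))] with t ht ht'
  rw [div_le_iff₀ hq'q] at ht'
  rw [id_eq] at ht
  linarith

lemma upperGrowthRate_comp_add_sub (f : ℝ → ℝ) (s b : ℝ) :
    upperGrowthRate (fun t => f (s + t) - b) = upperGrowthRate f := by
  refine (upperGrowthRate_comp_add_sub_le f s b).antisymm ?_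
  simpa using upperGrowthRate_comp_add_sub_le (fun t => f (s + t) - b) (-s) (-b)

lemma tendsto_div_of_upperGrowthRate_le {c : ℝ} (hf : upperGrowthRate f ≤ c)
    (hf' : upperGrowthRate (-f) ≤ -c) : Tendsto (fun t => f t / t) atTop (𝓝 c) := by
  have hneg : upperGrowthRate (-f) = -liminf (fun t => ((f t / t : ℝ) : EReal)) atTop := by
    rw [← EReal.limsup_neg]
    simp only [upperGrowthRate, Pi.neg_def, neg_div, EReal.coe_neg]
  rw [hneg, EReal.neg_le_neg_iff] at hf'
  exact EReal.tendsto_coe.1 (tendsto_of_le_liminf_of_limsup_le hf' hf)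

/-- Each value of `f` on `[0, ∞)` is bounded by the value of `f` at a point of `hℕ` at distance at
most `h`. This is the common feature of increasing and of decreasing functions which makes their
upper growth rate visible along `hℕ`. -/
def IsDominatedOnGrid (h : ℝ) (f : ℝ → ℝ) : Prop :=
  ∀ t, 0 ≤ t → ∃ n : ℕ, |n * h - t| ≤ h ∧ f t ≤ f (n * h)

lemma isDominatedOnGrid_of_monotone (hf : Monotone f) (hh : 0 < h) : IsDominatedOnGrid h f := by
  intro t ht
  have hle : t ≤ ⌈t / h⌉₊ * h := (div_le_iff₀ hh).1 (Nat.le_ceil _)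
  have hlt : ⌈t / h⌉₊ * h < (t / h + 1) * h := by gcongr; exact Nat.ceil_lt_add_one (by positivity)
  rw [add_mul, div_mul_cancel₀ _ hh.ne', one_mul] at hlt
  exact ⟨⌈t / h⌉₊, abs_le.2 ⟨by linarith, by linarith⟩, hf hle⟩

lemma isDominatedOnGrid_of_antitone (hf : Antitone f) (hh : 0 < h) : IsDominatedOnGrid h f := by
  intro t ht
  have hle : ⌊t / h⌋₊ * h ≤ t := (le_div_iff₀ hh).1 (Nat.floor_le (by positivity))
  have hlt : t < (⌊t / h⌋₊ + 1) * h := (div_lt_iff₀ hh).1 (Nat.lt_floor_add_one _)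
  exact ⟨⌊t / h⌋₊, abs_le.2 ⟨by linarith, by linarith⟩, hf hle⟩

lemma IsDominatedOnGrid.upperGrowthRate_eq (hf : IsDominatedOnGrid h f) (hh : 0 < h) :
    upperGrowthRate f = limsup (fun n : ℕ => ((f (n * h) / (n * h) : ℝ) : EReal)) atTop := by
  have hgrid : Tendsto (fun n : ℕ => (n : ℝ) * h) atTop atTop :=
    tendsto_natCast_atTop_atTop.atTop_mul_const hh
  refine le_antisymm (upperGrowthRate_le_iff.2 fun q hq => ?_)
    (hgrid.limsup_comp_le_limsup (u := fun t => ((f t / t : ℝ) : EReal)))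
  obtain ⟨q', hfq', hq'q⟩ := EReal.lt_iff_exists_real_btwn.1 hq
  have hq'q : 0 < q - q' := sub_pos.2 (EReal.coe_lt_coe_iff.1 hq'q)
  obtain ⟨n₀, hn₀⟩ := eventually_atTop.1 (eventually_lt_of_limsup_lt hfq')
  filter_upwards [eventually_gt_atTop (h + n₀ * h), eventually_ge_atTop (|q'| * h / (q - q'))]
    with t ht ht'
  obtain ⟨n, hnt, hle⟩ := hf t (by nlinarith [n₀.cast_nonneg (α := ℝ)])
  have hnh : n₀ * h < n * h := by linarith [(abs_le.1 hnt).1]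
  have hpos : 0 < n * h := hnh.trans_le' (by positivity)
  have hnn₀ : n₀ ≤ n := by exact_mod_cast (lt_of_mul_lt_mul_right hnh hh.le).le
  have hn := EReal.coe_lt_coe_iff.1 (hn₀ n hnn₀)
  rw [div_le_iff₀ hq'q] at ht'
  calc f t ≤ f (n * h) := hle
    _ ≤ q' * (n * h) := ((div_lt_iff₀ hpos).1 hn).le
    _ = q' * t + q' * (n * h - t) := by ring
    _ ≤ q' * t + |q'| * h := by
        have hdev : |q' * (n * h - t)| ≤ |q'| * h := by rw [abs_mul]; gcongr
        linarith [le_abs_self (q' * (n * h - t))]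
    _ ≤ q * t := by linarith

end GrowthRate

section ErgodicFlow

lemma ae_eq_const_of_forall_comp_vadd_ae_eq {G Ω Y : Type*} [VAdd G Ω] [MeasurableSpace Ω]
    {P : Measure Ω} [ErgodicVAdd G Ω P] [Nonempty Y] [MeasurableSpace Y]
    [MeasurableSpace.CountablySeparated Y] {u : Ω → Y} (hu : Measurable u)
    (hinv : ∀ g : G, (fun ω => u (g +ᵥ ω)) =ᵐ[P] u) : ∃ c, u =ᵐ[P] fun _ => c :=
  exists_eventuallyEq_const_of_forall_separating MeasurableSet fun U hU =>
    eventuallyConst_set.1 <|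
      ErgodicVAdd.aeconst_of_forall_preimage_vadd_ae_eq (G := G) (hu hU) fun g =>
        (hinv g).mono fun _ hω => congrArg (· ∈ U) hω

variable {Ω : Type*} [MeasurableSpace Ω] [VAdd ℝ Ω] {P : Measure Ω} {N : Ω → ℝ → ℝ} {h : ℝ}

/-- `N` is almost surely an additive cocycle over the flow `t ↦ (t +ᵥ ·)`: the value of `N` at time
`s + t` is its value at time `s` plus its value at time `t` seen from `s +ᵥ ω`. -/
structure IsAECocycle (P : Measure Ω) (N : Ω → ℝ → ℝ) : Prop where
  zero : ∀ᵐ ω ∂P, N ω 0 = 0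
  vadd : ∀ᵐ ω ∂P, ∀ s t, N (s +ᵥ ω) t = N ω (s + t) - N ω s

lemma IsAECocycle.neg (hN : IsAECocycle P N) : IsAECocycle P (-N) where
  zero := hN.zero.mono fun ω hω => by simp only [Pi.neg_apply, hω, neg_zero]
  vadd := hN.vadd.mono fun ω hω s t => by
    simp only [Pi.neg_apply, hω, neg_sub_neg, neg_sub]

lemma IsAECocycle.ae_upperGrowthRate_vadd (hN : IsAECocycle P N) (s : ℝ) :
    ∀ᵐ ω ∂P, upperGrowthRate (N (s +ᵥ ω)) = upperGrowthRate (N ω) :=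
  hN.vadd.mono fun ω hω => by
    rw [← upperGrowthRate_comp_add_sub (N ω) s (N ω s)]
    exact congrArg upperGrowthRate (funext (hω s))

variable [MeasurableConstVAdd ℝ Ω]

lemma IsAECocycle.ae_birkhoffAverage_eq [VAddInvariantMeasure ℝ Ω P] (hN : IsAECocycle P N)
    (h : ℝ) :
    ∀ᵐ ω ∂P, ∀ n : ℕ, birkhoffAverage ℝ (h +ᵥ ·) (fun ω => N ω h) n ω = N ω (n * h) / n := by
  have hvadd : ∀ᵐ ω ∂P, ∀ n : ℕ, ∀ t,
      N (h +ᵥ (h +ᵥ ·)^[n] ω) t = N ((h +ᵥ ·)^[n] ω) (h + t) - N ((h +ᵥ ·)^[n] ω) h :=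
    ae_all_iff.2 fun n => (((measurePreserving_vadd h P).iterate n).quasiMeasurePreserving.ae
      hN.vadd).mono fun ω hω => hω h
  filter_upwards [hN.zero, hvadd] with ω h0 hω n
  have hiterate : ∀ (n : ℕ) t, N ((h +ᵥ ·)^[n] ω) t = N ω (n * h + t) - N ω (n * h) := by
    intro n
    induction n with
    | zero => simp [h0]
    | succ n ih =>
      intro t
      rw [Function.iterate_succ_apply', hω n, ih, ih]
      push_cast
      ring_nf
  have hsum : birkhoffSum (h +ᵥ ·) (fun ω => N ω h) n ω = N ω (n * h) := by
    induction n with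
    | zero => simp [h0]
    | succ n ih =>
      rw [birkhoffSum_succ, ih, hiterate]
      push_cast
      ring_nf
  rw [birkhoffAverage, hsum, smul_eq_mul, inv_mul_eq_div]

variable [ErgodicVAdd ℝ Ω P] [IsProbabilityMeasure P]

/- Only the flow, and not the time `h` map, is ergodic, so the upper growth rate along the multiples
of `h` is first identified with the one over continuous time, which is invariant under the flow. -/
theorem IsAECocycle.ae_upperGrowthRate_le (hN : IsAECocycle P N)
    (hmeas : ∀ t, Measurable fun ω => N ω t) (hh : 0 < h)
    (hgrid : ∀ᵐ ω ∂P, IsDominatedOnGrid h (N ω)) (hint : Integrable (fun ω => N ω h) P) :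
    ∀ᵐ ω ∂P, upperGrowthRate (N ω) ≤ ((∫ ω, N ω h ∂P) / h : ℝ) := by
  let u : Ω → EReal := fun ω => limsup (fun n : ℕ => ((N ω (n * h) / (n * h) : ℝ) : EReal)) atTop
  have hu : ∀ᵐ ω ∂P, upperGrowthRate (N ω) = u ω := hgrid.mono fun ω hω => hω.upperGrowthRate_eq hh
  obtain ⟨c, hc⟩ : ∃ c, u =ᵐ[P] fun _ => c := by
    refine ae_eq_const_of_forall_comp_vadd_ae_eq (G := ℝ)
      (Measurable.limsup fun n => ((hmeas _).div_const _).coe_real_ereal) fun s => ?_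
    filter_upwards [hN.ae_upperGrowthRate_vadd s, hu,
      (measurePreserving_vadd s P).quasiMeasurePreserving.ae hu] with ω hω huω husω
    rw [← husω, hω, huω]
  suffices hcI : c ≤ ((∫ ω, N ω h ∂P) / h : ℝ) by
    filter_upwards [hu, hc] with ω huω hcω
    rwa [huω, hcω]
  by_contra! hlt
  obtain ⟨q, hIq, hqc⟩ := EReal.lt_iff_exists_real_btwn.1 hlt
  rw [EReal.coe_lt_coe_iff, div_lt_iff₀ hh] at hIq
  refine hIq.not_ge (le_integral_of_ae_exists_le_birkhoffAverage (measurePreserving_vadd h P)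
    hint ?_)
  filter_upwards [hN.ae_birkhoffAverage_eq h, hc] with ω havg hcω
  have hqu : (q : EReal) < u ω := hcω ▸ hqc
  obtain ⟨n, hn, hn0⟩ := ((frequently_lt_of_lt_limsup (by isBoundedDefault) hqu).and_eventually
    (eventually_ne_atTop 0)).exists
  obtain ⟨n, rfl⟩ := Nat.exists_eq_succ_of_ne_zero hn0
  refine ⟨n, ?_⟩
  rw [EReal.coe_lt_coe_iff, ← div_div, lt_div_iff₀ hh] at hn
  exact (havg (n + 1)).symm ▸ hn.le

theorem IsAECocycle.ae_tendsto_div (hN : IsAECocycle P N) (hmeas : ∀ t, Measurable fun ω => N ω t)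
    (hmono : ∀ᵐ ω ∂P, Monotone (N ω)) (hh : 0 < h) (hint : Integrable (fun ω => N ω h) P) :
    ∀ᵐ ω ∂P, Tendsto (fun t => N ω t / t) atTop (𝓝 ((∫ ω, N ω h ∂P) / h)) := by
  have hupper := hN.ae_upperGrowthRate_le hmeas hh
    (hmono.mono fun ω hω => isDominatedOnGrid_of_monotone hω hh) hint
  have hlower := hN.neg.ae_upperGrowthRate_le (fun t => (hmeas t).neg) hh
    (hmono.mono fun ω hω => isDominatedOnGrid_of_antitone hω.neg hh) hint.neg
  filter_upwards [hupper, hlower] with ω hupper hlower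
  refine tendsto_div_of_upperGrowthRate_le hupper ?_
  simpa only [Pi.neg_apply, integral_neg, neg_div, EReal.coe_neg] using hlower

end ErgodicFlow

section NegLogMass

variable {X : Type*} [PseudoMetricSpace X] [MeasurableSpace X] {μ : Measure X} {x : X}

/-- `-log μ(B_r(x))` as a function of the time `t = -log r`. Scaling acts on `t` by translation, and
the local dimension of `μ` at `x` is the growth rate of this function. -/
noncomputable def negLogMass (μ : Measure X) (x : X) (t : ℝ) : ℝ :=
  -Real.log (μ.real (closedBall x (Real.exp (-t))))

lemma negLogMass_neg_log (μ : Measure X) (x : X) {r : ℝ} (hr : 0 < r) :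
    negLogMass μ x (-Real.log r) = -Real.log (μ.real (closedBall x r)) := by
  rw [negLogMass, neg_neg, Real.exp_log hr]

lemma measurable_negLogMass [OpensMeasurableSpace X] (x : X) (t : ℝ) :
    Measurable fun μ : Measure X => negLogMass μ x t :=
  (Measure.measurable_coe measurableSet_closedBall).ennreal_toReal.log.neg

lemma measure_closedBall_pos_of_mem_support (hx : x ∈ μ.support) {r : ℝ} (hr : 0 < r) :
    0 < μ (closedBall x r) :=
  (Measure.mem_support_iff_forall x).1 hx _ (closedBall_mem_nhds x hr)

variable [ProperSpace X] [IsLocallyFiniteMeasure μ]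

lemma measureReal_closedBall_pos_of_mem_support (hx : x ∈ μ.support) {r : ℝ} (hr : 0 < r) :
    0 < μ.real (closedBall x r) :=
  ENNReal.toReal_pos (measure_closedBall_pos_of_mem_support hx hr).ne'
    (isCompact_closedBall x r).measure_ne_top

lemma monotone_negLogMass (hx : x ∈ μ.support) : Monotone (negLogMass μ x) := fun s t hst => by
  refine neg_le_neg (Real.log_le_log
    (measureReal_closedBall_pos_of_mem_support hx (Real.exp_pos _)) ?_)
  exact measureReal_mono (closedBall_subset_closedBall (by gcongr))
    (isCompact_closedBall _ _).measure_ne_top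

end NegLogMass

section LocalDimension

theorem ae_exists_mul_measureReal_closedBall_le {X : Type*} [MetricSpace X] [ProperSpace X]
    [HasBesicovitchCovering X] [MeasurableSpace X] [BorelSpace X] (μ ν : Measure X)
    [IsLocallyFiniteMeasure μ] [IsLocallyFiniteMeasure ν] :
    ∀ᵐ x ∂μ, ∃ c > 0, ∀ᶠ r in 𝓝[>] 0, c * ν.real (closedBall x r) ≤ μ.real (closedBall x r) := by
  filter_upwards [Besicovitch.ae_tendsto_rnDeriv ν μ, ν.rnDeriv_lt_top μ,
    Measure.support_mem_ae (μ := μ)] with x htend hfin hx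
  obtain ⟨C, hC, -⟩ := ENNReal.lt_iff_exists_nnreal_btwn.1 hfin
  have hC0 : 0 < (C : ℝ) := NNReal.coe_pos.2 (ENNReal.coe_pos.1 (pos_of_gt hC))
  refine ⟨(C : ℝ)⁻¹, inv_pos.2 hC0, ?_⟩
  filter_upwards [htend.eventually_lt_const hC, self_mem_nhdsWithin] with r hr (hr0 : 0 < r)
  have hμfin : μ (closedBall x r) ≠ ∞ := (isCompact_closedBall x r).measure_ne_top
  have hle : ν (closedBall x r) ≤ C * μ (closedBall x r) := ((ENNReal.div_lt_iff
    (Or.inl (measure_closedBall_pos_of_mem_support hx hr0).ne') (Or.inl hμfin)).1 hr).le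
  rw [inv_mul_le_iff₀ hC0]
  simpa only [ENNReal.toReal_mul, ENNReal.coe_toReal] using!
    ENNReal.toReal_mono (ENNReal.mul_ne_top ENNReal.coe_ne_top hμfin) hle

theorem ae_upperGrowthRate_negLogMass_le {E : Type*} [NormedAddCommGroup E] [NormedSpace ℝ E]
    [FiniteDimensional ℝ E] [MeasurableSpace E] [BorelSpace E] (μ : Measure E)
    [IsLocallyFiniteMeasure μ] :
    ∀ᵐ x ∂μ, upperGrowthRate (negLogMass μ x) ≤ (Module.finrank ℝ E : ℝ) := by
  have : ProperSpace E := FiniteDimensional.proper_real E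
  filter_upwards [ae_exists_mul_measureReal_closedBall_le μ Measure.addHaar] with x ⟨c, hc, hx⟩
  refine upperGrowthRate_le_iff.2 fun q hq => ?_
  set a := c * (Measure.addHaar : Measure E).real (ball 0 1)
  have ha : 0 < a := mul_pos hc
    (ENNReal.toReal_pos (measure_ball_pos _ _ one_pos).ne' measure_ball_lt_top.ne)
  have hexp : Tendsto (fun t => Real.exp (-t)) atTop (𝓝[>] 0) :=
    tendsto_nhdsWithin_iff.2 ⟨Real.tendsto_exp_neg_atTop_nhds_zero,
      Eventually.of_forall fun t => Real.exp_pos _⟩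
  have hdq : 0 < q - Module.finrank ℝ E := sub_pos.2 (EReal.coe_lt_coe_iff.1 hq)
  filter_upwards [hexp.eventually hx,
    eventually_ge_atTop (-Real.log a / (q - Module.finrank ℝ E))] with t ht hta
  rw [Measure.addHaar_real_closedBall _ _ (Real.exp_pos _).le, mul_left_comm, ← Real.exp_nat_mul]
    at ht
  have hlog := Real.log_le_log (by positivity) ht
  rw [Real.log_mul (Real.exp_pos _).ne' ha.ne', Real.log_exp] at hlog
  rw [div_le_iff₀ hdq] at hta
  rw [negLogMass]
  linarith

end LocalDimension

namespace FractalDistribution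

variable {d : ℕ} {μ : Measure (Space d)} {P : Measure (Measure (Space d))} {x : Space d} {h : ℝ}

section Normalization

lemma translateStar_closedBall (μ : Measure (Space d)) (x : Space d) (r : ℝ) :
    translateStar x μ (closedBall 0 r) = (μ (closedBall x 1))⁻¹ * μ (closedBall x r) := by
  have hmap : ∀ r, (μ.map fun y => y - x) (closedBall 0 r) = μ (closedBall x r) := fun r => by
    rw [Measure.map_apply (by fun_prop) measurableSet_closedBall]
    congr 1
    ext y
    rw [mem_preimage, mem_closedBall_zero_iff, mem_closedBall_iff_norm]
  rw [translateStar, normalize, Measure.smul_apply, smul_eq_mul, hmap, hmap]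

lemma scaleStar_closedBall (μ : Measure (Space d)) (t r : ℝ) :
    scaleStar t μ (closedBall 0 r) =
      (μ (closedBall 0 (Real.exp (-t))))⁻¹ * μ (closedBall 0 (Real.exp (-t) * r)) := by
  have hmap : ∀ r, (μ.map fun y => Real.exp t • y) (closedBall 0 r) =
      μ (closedBall 0 (Real.exp (-t) * r)) := fun r => by
    rw [Measure.map_apply (by fun_prop) measurableSet_closedBall]
    congr 1
    ext y
    simp only [mem_preimage, mem_closedBall_zero_iff, norm_smul, Real.norm_eq_abs, Real.abs_exp,
      Real.exp_neg]
    rw [← div_eq_inv_mul, le_div_iff₀' (Real.exp_pos t)]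
  rw [scaleStar, normalize, Measure.smul_apply, smul_eq_mul, hmap, hmap, mul_one]

lemma negLogMass_zero (hμ : μ ∈ normalizedMeasures d) : negLogMass μ 0 0 = 0 := by
  simp only [negLogMass, Measure.real, neg_zero, Real.exp_zero, hμ.2, ENNReal.toReal_one,
    Real.log_one]

variable [IsLocallyFiniteMeasure μ]

lemma zero_mem_support_translateStar (hx : x ∈ μ.support) : 0 ∈ (translateStar x μ).support :=
  nhds_basis_closedBall.mem_measureSupport.2 fun r hr => by
    rw [translateStar_closedBall]
    exact ENNReal.mul_pos (ENNReal.inv_ne_zero.2 (isCompact_closedBall x 1).measure_ne_top)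
      (measure_closedBall_pos_of_mem_support hx hr).ne'

lemma negLogMass_translateStar (hx : x ∈ μ.support) (t : ℝ) :
    negLogMass (translateStar x μ) 0 t = negLogMass μ x t - negLogMass μ x 0 := by
  simp only [negLogMass, Measure.real, translateStar_closedBall, ENNReal.toReal_mul,
    ENNReal.toReal_inv, neg_zero, Real.exp_zero]
  rw [Real.log_mul, Real.log_inv]
  · ring
  · exact (inv_pos.2 (measureReal_closedBall_pos_of_mem_support hx one_pos)).ne'
  · exact (measureReal_closedBall_pos_of_mem_support hx (Real.exp_pos _)).ne'

lemma negLogMass_scaleStar (h0 : 0 ∈ μ.support) (s t : ℝ) :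
    negLogMass (scaleStar s μ) 0 t = negLogMass μ 0 (s + t) - negLogMass μ 0 s := by
  simp only [negLogMass, Measure.real, scaleStar_closedBall, ENNReal.toReal_mul,
    ENNReal.toReal_inv, neg_add, Real.exp_add]
  rw [Real.log_mul, Real.log_inv]
  · ring
  · exact (inv_pos.2 (measureReal_closedBall_pos_of_mem_support h0 (Real.exp_pos _))).ne'
  · exact (measureReal_closedBall_pos_of_mem_support h0 (by positivity)).ne'

lemma logQuotient_eq_negLogMass_div (hx : x ∈ μ.support) {r : ℝ} (hr : 0 < r) :
    logQuotient μ x r = (negLogMass μ x (-Real.log r) / -Real.log r : ℝ) := by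
  rw [negLogMass_neg_log μ x hr, neg_div_neg_eq, logQuotient,
    ENNReal.log_pos_real' (measureReal_closedBall_pos_of_mem_support hx hr), EReal.coe_div,
    Measure.real]

lemma tendsto_logQuotient (hx : x ∈ μ.support) {α : ℝ}
    (hα : Tendsto (fun t => negLogMass (translateStar x μ) 0 t / t) atTop (𝓝 α)) :
    Tendsto (logQuotient μ x) (𝓝[>] 0) (𝓝 (α : EReal)) := by
  have hμα : Tendsto (fun t => negLogMass μ x t / t) atTop (𝓝 α) := by
    have hconst : Tendsto (fun t => negLogMass μ x 0 / t) atTop (𝓝 0) :=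
      tendsto_const_nhds.div_atTop tendsto_id
    simpa only [negLogMass_translateStar hx, ← add_div, sub_add_cancel, add_zero] using
      hα.add hconst
  have hlog : Tendsto (fun r => -Real.log r) (𝓝[>] 0) atTop :=
    tendsto_neg_atBot_atTop.comp Real.tendsto_log_nhdsGT_zero
  refine ((continuous_coe_real_ereal.tendsto α).comp (hμα.comp hlog)).congr' ?_
  filter_upwards [self_mem_nhdsWithin] with r hr
  exact (logQuotient_eq_negLogMass_div hx hr).symm

end Normalization

section QuasiPalm

theorem IsQuasiPalm.ae_of_forall_ae_translateStar (hq : IsQuasiPalm P)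
    (hP : ∀ᵐ μ ∂P, μ ∈ radonMeasures d) {p : Measure (Space d) → Prop}
    (hp : MeasurableSet {μ | p μ}) (h : ∀ μ ∈ radonMeasures d, ∀ᵐ x ∂μ, p (translateStar x μ)) :
    ∀ᵐ μ ∂P, p μ := by
  refine (hq (ball 0 1) isOpen_ball isBounded_ball (mem_ball_self one_pos)).1 ?_
  change P.bind (diffusion (ball 0 1)) {μ | p μ}ᶜ = 0
  rw [Measure.bind_apply hp.compl (aemeasurable_diffusion hP measurableSet_ball)]
  refine lintegral_eq_zero_of_ae_eq_zero ?_
  filter_upwards [hP] with μ hμ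
  rw [diffusion, Measure.map_apply (measurable_translateStar_left hμ) hp.compl]
  exact ae_restrict_of_ae (h μ hμ)

theorem IsQuasiPalm.ae_ae_translateStar (hq : IsQuasiPalm P) (hP : ∀ᵐ μ ∂P, μ ∈ radonMeasures d)
    {p : Measure (Space d) → Prop} (h : ∀ᵐ μ ∂P, p μ) :
    ∀ᵐ μ ∂P, ∀ᵐ x ∂μ, p (translateStar x μ) := by
  have hball : ∀ᵐ μ ∂P, ∀ n : ℕ, ∀ᵐ x ∂μ.restrict (ball 0 (n + 1)), p (translateStar x μ) := by
    refine ae_all_iff.2 fun n => ?_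
    have hbind := (hq (ball 0 (n + 1)) isOpen_ball isBounded_ball
      (mem_ball_self (by positivity))).2.ae_le h
    filter_upwards [hP,
      Measure.ae_ae_of_ae_bind (aemeasurable_diffusion hP measurableSet_ball) hbind] with μ hμ hdiff
    exact ae_of_ae_map (measurable_translateStar_left hμ).aemeasurable hdiff
  filter_upwards [hball] with μ hμ
  have hcover : ⋃ n : ℕ, ball (0 : Space d) (n + 1) = univ := iUnion_ball_nat_succ 0
  have hae := (ae_restrict_iUnion_iff _ _).2 hμ
  rwa [hcover, Measure.restrict_univ] at hae

lemma measurableSet_zero_mem_support :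
    MeasurableSet {μ : Measure (Space d) | 0 ∈ μ.support} := by
  simp only [nhds_basis_closedBall_inv_nat_succ.mem_measureSupport, forall_const, ofPred_forall]
  exact .iInter fun n =>
    measurableSet_lt measurable_const (Measure.measurable_coe measurableSet_closedBall)

end QuasiPalm

/-- The scaling flow `S^*`, as an action of the additive group of times: `t +ᵥ μ = S_t^* μ`. -/
noncomputable scoped instance : VAdd ℝ (Measure (Space d)) := ⟨scaleStar⟩

scoped instance : MeasurableConstVAdd ℝ (Measure (Space d)) := ⟨measurable_scaleStar⟩

namespace IsFractalDistribution

lemma vaddInvariantMeasure (hP : IsFractalDistribution P) : VAddInvariantMeasure ℝ _ P :=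
  ⟨fun t _ hA => (hP.invariant t).measure_preimage hA.nullMeasurableSet⟩

lemma ae_mem_radonMeasures (hP : IsFractalDistribution P) : ∀ᵐ μ ∂P, μ ∈ radonMeasures d :=
  hP.ae_mem.mono fun _ hμ => hμ.1

lemma ae_zero_mem_support (hP : IsFractalDistribution P) : ∀ᵐ μ ∂P, 0 ∈ μ.support :=
  hP.quasiPalm.ae_of_forall_ae_translateStar hP.ae_mem_radonMeasures
    measurableSet_zero_mem_support fun μ (_ : IsLocallyFiniteMeasure μ) => by
      filter_upwards [Measure.support_mem_ae (μ := μ)] with x hx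
      exact zero_mem_support_translateStar hx

lemma ae_monotone_negLogMass (hP : IsFractalDistribution P) :
    ∀ᵐ μ ∂P, Monotone (negLogMass μ 0) := by
  filter_upwards [hP.ae_mem_radonMeasures, hP.ae_zero_mem_support] with μ hμ h0
  have : IsLocallyFiniteMeasure μ := hμ
  exact monotone_negLogMass h0

lemma isAECocycle_negLogMass (hP : IsFractalDistribution P) :
    IsAECocycle P fun μ : Measure (Space d) => negLogMass μ 0 where
  zero := hP.ae_mem.mono fun _ hμ => negLogMass_zero hμ
  vadd := by
    filter_upwards [hP.ae_mem_radonMeasures, hP.ae_zero_mem_support] with μ hμ h0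
    have : IsLocallyFiniteMeasure μ := hμ
    exact negLogMass_scaleStar h0

lemma ae_exists_negLogMass_div_le (hP : IsFractalDistribution P) (hh : 0 < h) :
    ∀ᵐ μ ∂P, ∃ n : ℕ, negLogMass μ 0 ((n + 1 : ℕ) * h) / (n + 1 : ℕ) ≤ (d + 1) * h := by
  refine hP.quasiPalm.ae_of_forall_ae_translateStar hP.ae_mem_radonMeasures ?_
    fun μ (_ : IsLocallyFiniteMeasure μ) => ?_
  · simp only [ofPred_exists]
    exact .iUnion fun n => measurableSet_le ((measurable_negLogMass _ _).div_const _)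
      measurable_const
  filter_upwards [ae_upperGrowthRate_negLogMass_le μ, Measure.support_mem_ae (μ := μ)]
    with x hrate hx
  rw [← upperGrowthRate_comp_add_sub _ 0 (negLogMass μ x 0), Module.finrank_fin_fun] at hrate
  simp only [zero_add, ← negLogMass_translateStar hx] at hrate
  have hle := upperGrowthRate_le_iff.1 hrate (d + 1) (EReal.coe_lt_coe_iff.2 (lt_add_one _))
  have hgrid : Tendsto (fun n : ℕ => ((n + 1 : ℕ) : ℝ) * h) atTop atTop :=
    (tendsto_natCast_atTop_atTop.comp (tendsto_add_atTop_nat 1)).atTop_mul_const hh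
  obtain ⟨n, hn⟩ := (hgrid.eventually hle).exists
  exact ⟨n, (div_le_iff₀ (by positivity)).2 (hn.trans_eq (by ring))⟩

theorem integrable_negLogMass (hP : IsFractalDistribution P) (hh : 0 < h) :
    Integrable (fun μ => negLogMass μ 0 h) P := by
  have := hP.isProbabilityMeasure
  have := hP.vaddInvariantMeasure
  refine integrable_of_ae_exists_birkhoffAverage_le (c := (d + 1) * h)
    (measurePreserving_vadd h P) (measurable_negLogMass 0 h).aemeasurable ?_ ?_
  · filter_upwards [hP.ae_mem, hP.ae_monotone_negLogMass] with μ hμ hmono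
    exact (negLogMass_zero hμ).symm.trans_le (hmono hh.le)
  · filter_upwards [hP.isAECocycle_negLogMass.ae_birkhoffAverage_eq h,
      hP.ae_exists_negLogMass_div_le hh] with μ havg ⟨n, hn⟩
    exact ⟨n, (havg _).trans_le hn⟩

end IsFractalDistribution

/-- The dimension `dim P` of a fractal distribution: the mean of `log μ(B_r(0)) / log r`, which does
not depend on `0 < r < 1`, computed at `r = e⁻¹`. -/
noncomputable def dimension (P : Measure (Measure (Space d))) : ℝ :=
  ∫ μ, negLogMass μ 0 1 ∂P

namespace IsErgodicFractalDistribution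

lemma ergodicVAdd (hP : IsErgodicFractalDistribution P) : ErgodicVAdd ℝ _ P where
  toVAddInvariantMeasure := hP.vaddInvariantMeasure
  aeconst_of_forall_preimage_vadd_ae_eq {A} hA hinv := by
    have := hP.isProbabilityMeasure
    refine eventuallyConst_set.2 ?_
    rcases hP.ergodic A hA fun t => measure_symmDiff_eq_zero_iff.2 (hinv t) with h0 | h1
    · exact Or.inr (measure_eq_zero_iff_ae_notMem.1 h0)
    · exact Or.inl ((prob_compl_eq_zero_iff hA).2 h1)

theorem ae_tendsto_negLogMass_div (hP : IsErgodicFractalDistribution P) (hh : 0 < h) :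
    ∀ᵐ μ ∂P, Tendsto (fun t => negLogMass μ 0 t / t) atTop
      (𝓝 ((∫ μ, negLogMass μ 0 h ∂P) / h)) := by
  have := hP.isProbabilityMeasure
  have := hP.ergodicVAdd
  exact hP.isAECocycle_negLogMass.ae_tendsto_div (measurable_negLogMass 0)
    hP.ae_monotone_negLogMass hh (hP.integrable_negLogMass hh)

theorem ae_tendsto_negLogMass_div_dimension (hP : IsErgodicFractalDistribution P) :
    ∀ᵐ μ ∂P, Tendsto (fun t => negLogMass μ 0 t / t) atTop (𝓝 (dimension P)) := by
  simpa only [div_one, dimension] using hP.ae_tendsto_negLogMass_div one_pos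

theorem dimension_eq_integral_div (hP : IsErgodicFractalDistribution P) (hh : 0 < h) :
    dimension P = (∫ μ, negLogMass μ 0 h ∂P) / h := by
  have := hP.isProbabilityMeasure
  obtain ⟨μ, hdim, hmean⟩ :=
    (hP.ae_tendsto_negLogMass_div_dimension.and (hP.ae_tendsto_negLogMass_div hh)).exists
  exact tendsto_nhds_unique hdim hmean

theorem ae_hasExactDim (hP : IsErgodicFractalDistribution P) :
    ∀ᵐ μ ∂P, HasExactDim μ (dimension P : EReal) := by
  filter_upwards [hP.ae_mem_radonMeasures, hP.quasiPalm.ae_ae_translateStar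
    hP.ae_mem_radonMeasures hP.ae_tendsto_negLogMass_div_dimension] with μ hμ htend
  have : IsLocallyFiniteMeasure μ := hμ
  filter_upwards [htend, Measure.support_mem_ae (μ := μ)] with x hx hxsupp
  have hlim := tendsto_logQuotient hxsupp hx
  exact ⟨hlim.liminf_eq, hlim.limsup_eq⟩

end IsErgodicFractalDistribution

end FractalDistribution

theorem mainTheorem6 (d : ℕ) (P : Measure (Measure (FractalDistribution.Space d)))
    (hP : FractalDistribution.IsErgodicFractalDistribution P) :
    ∃ α : ℝ,
      (∀ᵐ μ ∂P, FractalDistribution.HasExactDim μ (α : EReal)) ∧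
      ∀ r : ℝ, 0 < r → r < 1 →
        Integrable (fun μ : Measure (FractalDistribution.Space d) =>
          Real.log (μ.real (closedBall 0 r)) / Real.log r) P ∧
        α = ∫ μ : Measure (FractalDistribution.Space d),
          Real.log (μ.real (closedBall 0 r)) / Real.log r ∂P := by
  refine ⟨FractalDistribution.dimension P, hP.ae_hasExactDim, fun r hr0 hr1 => ?_⟩
  have hlog : 0 < -Real.log r := neg_pos.2 (Real.log_neg hr0 hr1)
  have hquot : ∀ μ : Measure (FractalDistribution.Space d),
      Real.log (μ.real (closedBall 0 r)) / Real.log r =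
        negLogMass μ 0 (-Real.log r) / -Real.log r := fun μ => by
    rw [negLogMass_neg_log μ 0 hr0, neg_div_neg_eq]
  simp only [hquot, integral_div]
  exact ⟨(hP.integrable_negLogMass hlog).div_const _, hP.dimension_eq_integral_div hlog⟩
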